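/- Let $A$ be a unital $C^*$-algebra, $H$ a complex Hilbert space, and $\phi\colon A\to B(H)$ a positive linear map with $\phi(1)=1$. Suppose that $\phi$ is entanglement breaking, i.e. of the form $$\phi(x)=\sum_{i=1}^n \omega_i(x)\,b_i\qquad (x\in A)$$ with finitely many states $\omega_i$ of $A$ and positive operators $b_i\in B(H)$. Let $D_\phi=\{a\in A: a=a^*,\ \phi(a^2)=\phi(a)^2\}$ be the (self-adjoint) definite set of $\phi$. Then: (1) For every projection $e\in D_\phi$, with $f=1-e$, the operators $\phi(e)$ and $\phi(f)$ are projections in $B(H)$, and for all $x\in A$ $$\phi(x)=\phi(exe)+\phi(fxf)=\phi(e)\phi(x)\phi(e)+\phi(f)\phi(x)\phi(f).$$ (2) $\phi(D_\phi)$ is the self-adjoint part of an abelian $C^*$-subalgebra of $B(H)$ (containing the identity), and this $C^*$-algebra is contained in the center of the von Neumann algebra generated by $\phi(A)$. (3) If $\phi$ is faithful (that is, $x\ge 0$ and $\phi(x)=0$ imply $x=0$), then $D_\phi$ is the self-adjoint part of an abelian $C^*$-subalgebra of $A$ (containing the identity). -/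

import Mathlib

open scoped ComplexOrder

/-- A positive linear functional `ω` on a unital C⋆-algebra is a state if `ω 1 = 1`. -/
def IsState {A : Type*} [CStarAlgebra A] [PartialOrder A] [StarOrderedRing A]
    (ω : A →ₚ[ℂ] ℂ) : Prop :=
  ω 1 = 1

/-- A map into `B(H)` is entanglement breaking (of Holevo form) if it is a finite sum
`x ↦ ∑ i, ω i x • b i` with states `ω i` and positive bounded operators `b i`. -/
def IsEntanglementBreaking {A : Type*} [CStarAlgebra A] [PartialOrder A] [StarOrderedRing A]
    {H : Type*} [NormedAddCommGroup H] [InnerProductSpace ℂ H] [CompleteSpace H]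
    (φ : A →ₚ[ℂ] (H →L[ℂ] H)) : Prop :=
  ∃ (n : ℕ) (ω : Fin n → (A →ₚ[ℂ] ℂ)) (b : Fin n → (H →L[ℂ] H)),
    (∀ i, IsState (ω i)) ∧ (∀ i, 0 ≤ b i) ∧ ∀ x, φ x = ∑ i, ω i x • b i

/-- The (self-adjoint) definite set of a map: all self-adjoint `a` with `φ (a ^ 2) = φ a ^ 2`. -/
def definiteSet {A B : Type*} [CStarAlgebra A] [CStarAlgebra B] (φ : A → B) : Set A :=
  {a | IsSelfAdjoint a ∧ φ (a ^ 2) = φ a ^ 2}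

/-- A positive map is faithful if it vanishes on no nonzero positive element. -/
def IsFaithfulMap {A B : Type*} [CStarAlgebra A] [PartialOrder A] [CStarAlgebra B]
    (φ : A → B) : Prop :=
  ∀ x : A, 0 ≤ x → φ x = 0 → x = 0

/-- `S` is the self-adjoint part of the unital C⋆-subalgebra `C` (a norm closed
⋆-subalgebra), and `C` is abelian. -/
def IsSelfAdjointPartOfAbelian {B : Type*} [CStarAlgebra B] (C : StarSubalgebra ℂ B)
    (S : Set B) : Prop :=
  IsClosed (C : Set B) ∧ (∀ x ∈ C, ∀ y ∈ C, x * y = y * x) ∧ S = {x | x ∈ C ∧ IsSelfAdjoint x}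

/-- The von Neumann algebra generated by a set of bounded operators: the double commutant of
`S ∪ star S`. -/
noncomputable def generatedVonNeumann {H : Type*} [NormedAddCommGroup H] [InnerProductSpace ℂ H]
    [CompleteSpace H] (S : Set (H →L[ℂ] H)) : VonNeumannAlgebra H where
  toStarSubalgebra :=
    StarSubalgebra.centralizer ℂ (StarSubalgebra.centralizer ℂ S : Set (H →L[ℂ] H))
  centralizer_centralizer' := by simp

/-- `generatedVonNeumann S` contains `S`. -/
theorem subset_generatedVonNeumann {H : Type*} [NormedAddCommGroup H] [InnerProductSpace ℂ H]
    [CompleteSpace H] (S : Set (H →L[ℂ] H)) :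
    S ⊆ (generatedVonNeumann S : Set (H →L[ℂ] H)) :=
  fun _ hx => StarAlgebra.adjoin_le_centralizer_centralizer ℂ S
    (StarAlgebra.subset_adjoin ℂ S hx)

/-- `generatedVonNeumann S` is the least von Neumann algebra containing `S`. -/
theorem generatedVonNeumann_le {H : Type*} [NormedAddCommGroup H] [InnerProductSpace ℂ H]
    [CompleteSpace H] (S : Set (H →L[ℂ] H)) (M : VonNeumannAlgebra H)
    (hS : S ⊆ (M : Set (H →L[ℂ] H))) : generatedVonNeumann S ≤ M := by
  intro x hx
  have hx' : x ∈ (StarSubalgebra.centralizer ℂ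
      (StarSubalgebra.centralizer ℂ S : Set (H →L[ℂ] H)) : Set (H →L[ℂ] H)) := hx
  rw [StarSubalgebra.coe_centralizer_centralizer] at hx'
  have hsub : S ∪ star S ⊆ (M : Set (H →L[ℂ] H)) := by
    refine Set.union_subset hS fun y hy => ?_
    have h : star (star y) ∈ M := star_mem (hS hy)
    simpa using h
  have := Set.centralizer_subset (Set.centralizer_subset hsub) hx'
  rw [M.centralizer_centralizer] at this
  exact this

/-- The center of a von Neumann algebra `M`, that is, `M ∩ M'`. -/
def vonNeumannCenter {H : Type*} [NormedAddCommGroup H] [InnerProductSpace ℂ H]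
    [CompleteSpace H] (M : VonNeumannAlgebra H) : Set (H →L[ℂ] H) :=
  {z | z ∈ M ∧ ∀ y ∈ M, y * z = z * y}

/-! Since `φ 1 = 1` gives `∑ b i = 1`, the defect `φ (a ^ 2) - φ a ^ 2` is a sum of positive terms:
`b i` conjugated by `φ a - ω i a`, plus the variance of `a` in `ω i` times `b i`
(`sum_conjugate_add_variance`). If the defect is zero, every term is zero. Hence `b i` absorbs `φ a`
on both sides as the scalar `ω i a`, and `ω i` is multiplicative at `a` unless `b i = 0`. Summing,
`φ (a * x) = φ a * φ x = φ x * φ a = φ (x * a)` for all `x`. The definite set is thus the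
self-adjoint part of a closed star subalgebra on which `φ` is a homomorphism with central image, and
all three claims follow. -/

/-! ### Zero variance makes a state multiplicative. -/

section State

variable {A : Type*} [CStarAlgebra A] [PartialOrder A] [StarOrderedRing A]

/-- Degenerate case of the Cauchy-Schwarz inequality for a positive functional. -/
theorem PositiveLinearMap.apply_star_mul_eq_zero (ω : A →ₚ[ℂ] ℂ) {c : A}
    (hc : ω (star c * c) = 0) (x : A) : ω (star c * x) = 0 := by
  have hn : ‖ω.toPreGNS c‖ = 0 := by
    rw [PositiveLinearMap.preGNS_norm_def]
    simp [hc]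
  have h := norm_inner_le_norm (𝕜 := ℂ) (ω.toPreGNS c) (ω.toPreGNS x)
  rw [hn, zero_mul, PositiveLinearMap.preGNS_inner_def] at h
  exact norm_le_zero_iff.mp h

theorem PositiveLinearMap.apply_mul_star_eq_zero (ω : A →ₚ[ℂ] ℂ) {c : A}
    (hc : ω (star c * c) = 0) (x : A) : ω (x * c) = 0 := by
  have h := ω.apply_star_mul_eq_zero hc (star x)
  rw [← star_mul, map_star] at h
  exact star_eq_zero.mp h

theorem IsState.apply_sub_smul_one {ω : A →ₚ[ℂ] ℂ} (hω : IsState ω) (a : A) :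
    ω ((a - ω a • 1) * (a - ω a • 1)) = ω (a ^ 2) - ω a ^ 2 := by
  have h1 : ω 1 = 1 := hω
  simp only [sub_mul, mul_sub, smul_mul_assoc, mul_smul_comm, one_mul, mul_one, map_sub, map_smul,
    h1, smul_eq_mul, sq]
  ring

theorem PositiveLinearMap.isSelfAdjoint_sub_smul_one (ω : A →ₚ[ℂ] ℂ) {a : A}
    (ha : IsSelfAdjoint a) : IsSelfAdjoint (a - ω a • 1) :=
  ha.sub ((ha.map ω).smul (.one A))

/-- The variance of a self-adjoint element in a state is nonnegative. -/
theorem IsState.variance_nonneg {ω : A →ₚ[ℂ] ℂ} (hω : IsState ω) {a : A} (ha : IsSelfAdjoint a) :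
    0 ≤ ω (a ^ 2) - ω a ^ 2 := by
  rw [← hω.apply_sub_smul_one]
  exact ω.map_nonneg (ω.isSelfAdjoint_sub_smul_one ha).mul_self_nonneg

/-- A state is multiplicative at a self-adjoint element of zero variance. -/
theorem IsState.map_mul_of_variance_eq_zero {ω : A →ₚ[ℂ] ℂ} (hω : IsState ω) {a : A}
    (ha : IsSelfAdjoint a) (hv : ω (a ^ 2) - ω a ^ 2 = 0) (x : A) :
    ω (a * x) = ω a * ω x ∧ ω (x * a) = ω x * ω a := by
  have hsa := (ω.isSelfAdjoint_sub_smul_one ha).star_eq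
  have hc : ω (star (a - ω a • 1) * (a - ω a • 1)) = 0 := by
    rw [hsa, hω.apply_sub_smul_one, hv]
  have h1 := ω.apply_star_mul_eq_zero hc x
  have h2 := ω.apply_mul_star_eq_zero hc x
  rw [hsa, sub_mul, smul_mul_assoc, one_mul, map_sub, map_smul, smul_eq_mul, sub_eq_zero] at h1
  rw [mul_sub, mul_smul_comm, mul_one, map_sub, map_smul, smul_eq_mul, sub_eq_zero,
    mul_comm (ω a)] at h2
  exact ⟨h1, h2⟩

end State

/-- If a self-adjoint conjugate of a positive element vanishes, so does the one-sided product. -/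
theorem mul_eq_zero_of_conjugate_eq_zero {B : Type*} [CStarAlgebra B] [PartialOrder B]
    [StarOrderedRing B] {b c : B} (hb : 0 ≤ b) (hc : IsSelfAdjoint c) (h : c * b * c = 0) :
    b * c = 0 ∧ c * b = 0 := by
  obtain ⟨s, rfl⟩ := CStarAlgebra.nonneg_iff_eq_star_mul_self.mp hb
  -- With `b = star s * s`, the hypothesis says `star (s * c) * (s * c) = 0`.
  have hs : s * c = 0 := by
    rw [← CStarRing.star_mul_self_eq_zero_iff, star_mul, hc.star_eq]
    simpa only [mul_assoc] using h
  have hs' : c * star s = 0 := by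
    rw [← hc.star_eq, ← star_mul, hs, star_zero]
  exact ⟨by rw [mul_assoc, hs, mul_zero], by rw [← mul_assoc, hs', zero_mul]⟩

/-! ### The central multiplicative domain of a unital positive map. -/

section MultiplicativeDomain

variable {A : Type*} [CStarAlgebra A] [PartialOrder A] [StarOrderedRing A]
  {B : Type*} [CStarAlgebra B] [PartialOrder B] [StarOrderedRing B]

/-- The elements at which a unital positive map is multiplicative and whose image commutes with
the range of the map. -/
def centralMultiplicativeDomain (φ : A →ₚ[ℂ] B) (h1 : φ 1 = 1) : StarSubalgebra ℂ A where
  carrier := {a | ∀ x, φ (a * x) = φ a * φ x ∧ φ (x * a) = φ x * φ a ∧ φ a * φ x = φ x * φ a}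
  mul_mem' {a b} ha hb x := by
    refine ⟨?_, ?_, ?_⟩
    · rw [mul_assoc, (ha _).1, (hb _).1, (ha b).1, mul_assoc]
    · rw [← mul_assoc, (hb _).2.1, (ha _).2.1, (ha b).1, mul_assoc]
    · rw [(ha b).1, mul_assoc, (hb x).2.2, ← mul_assoc, (ha x).2.2, mul_assoc]
  add_mem' {a b} ha hb x := by
    simp only [add_mul, mul_add, map_add, (ha x).1, (hb x).1, (ha x).2.1, (hb x).2.1,
      (ha x).2.2, (hb x).2.2, and_self]
  algebraMap_mem' r x := by
    simp [Algebra.algebraMap_eq_smul_one, h1]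
  star_mem' {a} ha x := by
    have h := ha (star x)
    refine ⟨?_, ?_, ?_⟩
    · simpa only [← map_star φ, star_mul, star_star] using congrArg star h.2.1
    · simpa only [← map_star φ, star_mul, star_star] using congrArg star h.1
    · simpa only [map_star, star_mul, star_star] using (congrArg star h.2.2).symm

theorem mem_centralMultiplicativeDomain {φ : A →ₚ[ℂ] B} {h1 : φ 1 = 1} {a : A} :
    a ∈ centralMultiplicativeDomain φ h1 ↔
      ∀ x, φ (a * x) = φ a * φ x ∧ φ (x * a) = φ x * φ a ∧ φ a * φ x = φ x * φ a :=
  Iff.rfl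

theorem isClosed_centralMultiplicativeDomain (φ : A →ₚ[ℂ] B) (h1 : φ 1 = 1) :
    IsClosed (centralMultiplicativeDomain φ h1 : Set A) := by
  have hφ : Continuous φ := map_continuous φ
  have : (centralMultiplicativeDomain φ h1 : Set A) =
      ⋂ x, {a | φ (a * x) = φ a * φ x} ∩
        ({a | φ (x * a) = φ x * φ a} ∩ {a | φ a * φ x = φ x * φ a}) := by
    ext a
    simp [mem_centralMultiplicativeDomain]
  rw [this]
  refine isClosed_iInter fun x => ?_
  refine (isClosed_eq ?_ ?_).inter ((isClosed_eq ?_ ?_).inter (isClosed_eq ?_ ?_)) <;> fun_prop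

/-- The restriction of a unital positive map to its central multiplicative domain. -/
noncomputable def centralMultiplicativeDomainHom (φ : A →ₚ[ℂ] B) (h1 : φ 1 = 1) :
    centralMultiplicativeDomain φ h1 →⋆ₐ[ℂ] B where
  toFun a := φ a
  map_one' := h1
  map_mul' a b := (a.2 b).1
  map_zero' := map_zero φ
  map_add' a b := map_add φ (a : A) b
  commutes' r := by
    simp [Algebra.algebraMap_eq_smul_one, h1]
  map_star' a := map_star φ (a : A)

theorem mem_range_centralMultiplicativeDomainHom {φ : A →ₚ[ℂ] B} {h1 : φ 1 = 1} {y : B} :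
    y ∈ (centralMultiplicativeDomainHom φ h1).range ↔
      ∃ a ∈ centralMultiplicativeDomain φ h1, φ a = y := by
  exact ⟨fun ⟨a, ha⟩ => ⟨a, a.2, ha⟩, fun ⟨a, ha, h⟩ => ⟨⟨a, ha⟩, h⟩⟩

/-- A faithful unital positive map has an abelian central multiplicative domain. -/
theorem centralMultiplicativeDomain_mul_comm {φ : A →ₚ[ℂ] B} {h1 : φ 1 = 1}
    (hφ : IsFaithfulMap φ) {a b : A} (ha : a ∈ centralMultiplicativeDomain φ h1)
    (hb : b ∈ centralMultiplicativeDomain φ h1) : a * b = b * a := by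
  -- The commutator stays in the domain, so `φ` is multiplicative on its square and faithfulness
  -- applies.
  have hc : a * b - b * a ∈ centralMultiplicativeDomain φ h1 :=
    sub_mem (mul_mem ha hb) (mul_mem hb ha)
  have h0 : φ (a * b - b * a) = 0 := by
    rw [map_sub, (ha b).1, (hb a).1, (ha b).2.2, sub_self]
  have h := hφ (star (a * b - b * a) * (a * b - b * a)) (star_mul_self_nonneg _)
    (by rw [(hc _).2.1, h0, mul_zero])
  exact sub_eq_zero.mp ((CStarRing.star_mul_self_eq_zero_iff _).mp h)

end MultiplicativeDomain

/-! ### Maps in Holevo form. -/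

section EntanglementBreaking

variable {A : Type*} [CStarAlgebra A] [PartialOrder A] [StarOrderedRing A]
  {H : Type*} [NormedAddCommGroup H] [InnerProductSpace ℂ H] [CompleteSpace H]
  {φ : A →ₚ[ℂ] (H →L[ℂ] H)}

/-- The defect in the Kadison-Schwarz inequality for a map in Holevo form. -/
theorem sum_conjugate_add_variance {n : ℕ} {ω : Fin n → (A →ₚ[ℂ] ℂ)} {b : Fin n → (H →L[ℂ] H)}
    (h1 : φ 1 = 1) (hω : ∀ i, IsState (ω i)) (hφ : ∀ x, φ x = ∑ i, ω i x • b i) (a : A) :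
    ∑ i, ((φ a - ω i a • 1) * b i * (φ a - ω i a • 1) +
      (ω i (a ^ 2) - ω i a ^ 2) • b i) = φ (a ^ 2) - φ a ^ 2 := by
  have hb : ∑ i, b i = 1 := by
    rw [← h1, hφ]
    refine Finset.sum_congr rfl fun i _ => ?_
    rw [show ω i 1 = 1 from hω i, one_smul]
  have hterm (i : Fin n) : (φ a - ω i a • 1) * b i * (φ a - ω i a • 1) +
      (ω i (a ^ 2) - ω i a ^ 2) • b i =
      φ a * b i * φ a - φ a * (ω i a • b i) - (ω i a • b i) * φ a + ω i (a ^ 2) • b i := by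
    simp only [sub_mul, mul_sub, smul_mul_assoc, mul_smul_comm, one_mul, mul_one, sub_smul, sq]
    module
  rw [Finset.sum_congr rfl fun i _ => hterm i]
  simp only [Finset.sum_add_distrib, Finset.sum_sub_distrib, ← Finset.mul_sum,
    ← Finset.sum_mul, hb, ← hφ, mul_one, sq]
  abel

theorem definiteSet_subset_centralMultiplicativeDomain (h1 : φ 1 = 1)
    (hφ : IsEntanglementBreaking φ) {a : A} (ha : a ∈ definiteSet φ) :
    a ∈ centralMultiplicativeDomain φ h1 := by
  obtain ⟨n, ω, b, hω, hb, hφ⟩ := hφ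
  obtain ⟨hsa, hdef⟩ := ha
  have hc (i : Fin n) : IsSelfAdjoint (φ a - ω i a • 1) :=
    (hsa.map φ).sub ((hsa.map (ω i)).smul (.one _))
  have hn1 (i : Fin n) : 0 ≤ (φ a - ω i a • 1) * b i * (φ a - ω i a • 1) :=
    (hc i).conjugate_nonneg (hb i)
  have hn2 (i : Fin n) : 0 ≤ (ω i (a ^ 2) - ω i a ^ 2) • b i :=
    smul_nonneg ((hω i).variance_nonneg hsa) (hb i)
  have hsum := sum_conjugate_add_variance h1 hω hφ a
  rw [hdef, sub_self, Finset.sum_eq_zero_iff_of_nonneg fun i _ => add_nonneg (hn1 i) (hn2 i)]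
    at hsum
  have hzero (i : Fin n) := (add_eq_zero_iff_of_nonneg (hn1 i) (hn2 i)).mp
    (hsum i (Finset.mem_univ i))
  have hleft (i : Fin n) : φ a * b i = ω i a • b i := by
    have h := (mul_eq_zero_of_conjugate_eq_zero (hb i) (hc i) (hzero i).1).2
    rwa [sub_mul, smul_mul_assoc, one_mul, sub_eq_zero] at h
  have hright (i : Fin n) : b i * φ a = ω i a • b i := by
    have h := (mul_eq_zero_of_conjugate_eq_zero (hb i) (hc i) (hzero i).1).1
    rwa [mul_sub, mul_smul_comm, mul_one, sub_eq_zero] at h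
  -- Multiplicativity of `ω i` may fail when `b i = 0`, so it is stated only after scaling `b i`.
  have hmul (i : Fin n) (x : A) : ω i (a * x) • b i = (ω i a * ω i x) • b i ∧
      ω i (x * a) • b i = (ω i x * ω i a) • b i := by
    rcases smul_eq_zero.mp (hzero i).2 with hv | hbi
    · have h := (hω i).map_mul_of_variance_eq_zero hsa hv x
      rw [h.1, h.2]
      exact ⟨rfl, rfl⟩
    · simp [hbi]
  intro x
  have hl : φ a * φ x = ∑ i, (ω i a * ω i x) • b i := by
    simp only [hφ x, Finset.mul_sum, mul_smul_comm, hleft, smul_smul, mul_comm]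
  have hr : φ x * φ a = ∑ i, (ω i x * ω i a) • b i := by
    simp only [hφ x, Finset.sum_mul, smul_mul_assoc, hright, smul_smul]
  refine ⟨?_, ?_, ?_⟩
  · rw [hl, hφ (a * x)]
    exact Finset.sum_congr rfl fun i _ => (hmul i x).1
  · rw [hr, hφ (x * a)]
    exact Finset.sum_congr rfl fun i _ => (hmul i x).2
  · rw [hl, hr]
    exact Finset.sum_congr rfl fun i _ => by rw [mul_comm]

theorem definiteSet_eq_selfAdjoint_centralMultiplicativeDomain (h1 : φ 1 = 1)
    (hφ : IsEntanglementBreaking φ) :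
    definiteSet φ = {a | a ∈ centralMultiplicativeDomain φ h1 ∧ IsSelfAdjoint a} := by
  ext a
  refine ⟨fun h => ⟨definiteSet_subset_centralMultiplicativeDomain h1 hφ h, h.1⟩,
    fun h => ⟨h.2, ?_⟩⟩
  rw [sq, sq, (h.1 a).1]

/-- An entanglement breaking map has finite-dimensional range. -/
theorem IsEntanglementBreaking.finiteDimensional_range (hφ : IsEntanglementBreaking φ) :
    FiniteDimensional ℂ (LinearMap.range φ.toLinearMap) := by
  obtain ⟨n, ω, b, -, -, hφ⟩ := hφ
  have : FiniteDimensional ℂ (Submodule.span ℂ (Set.range b)) :=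
    FiniteDimensional.span_of_finite ℂ (Set.finite_range b)
  refine Submodule.finiteDimensional_of_le (S₂ := Submodule.span ℂ (Set.range b)) ?_
  rintro _ ⟨x, rfl⟩
  rw [PositiveLinearMap.coe_toLinearMap, hφ]
  exact Submodule.sum_mem _ fun i _ =>
    Submodule.smul_mem _ _ (Submodule.subset_span (Set.mem_range_self i))

/-- The image lies in the span of the finitely many `b i`, and finite-dimensional subspaces are
closed. -/
theorem isClosed_range_centralMultiplicativeDomainHom (h1 : φ 1 = 1)
    (hφ : IsEntanglementBreaking φ) :
    IsClosed ((centralMultiplicativeDomainHom φ h1).range : Set (H →L[ℂ] H)) := by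
  have := hφ.finiteDimensional_range
  have hle : Subalgebra.toSubmodule (centralMultiplicativeDomainHom φ h1).range.toSubalgebra ≤
      LinearMap.range φ.toLinearMap := by
    intro y hy
    obtain ⟨a, -, rfl⟩ := mem_range_centralMultiplicativeDomainHom.mp hy
    exact ⟨a, rfl⟩
  have := Submodule.finiteDimensional_of_le hle
  exact Submodule.closed_of_finiteDimensional
    (Subalgebra.toSubmodule (centralMultiplicativeDomainHom φ h1).range.toSubalgebra)

theorem image_definiteSet (h1 : φ 1 = 1) (hφ : IsEntanglementBreaking φ) :
    φ '' definiteSet φ =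
      {y | y ∈ (centralMultiplicativeDomainHom φ h1).range ∧ IsSelfAdjoint y} := by
  rw [definiteSet_eq_selfAdjoint_centralMultiplicativeDomain h1 hφ]
  ext y
  constructor
  · rintro ⟨a, ⟨ha, hsa⟩, rfl⟩
    exact ⟨mem_range_centralMultiplicativeDomainHom.mpr ⟨a, ha, rfl⟩, hsa.map φ⟩
  · rintro ⟨hy, hsa⟩
    obtain ⟨a, ha, rfl⟩ := mem_range_centralMultiplicativeDomainHom.mp hy
    -- A preimage of a self-adjoint element need not be self-adjoint, but its real part has the same
    -- image.
    refine ⟨(2⁻¹ : ℂ) • (a + star a), ⟨(centralMultiplicativeDomain φ h1).smul_mem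
      (add_mem ha (star_mem ha)) _, ?_⟩, ?_⟩
    · exact IsSelfAdjoint.smul (by simp [isSelfAdjoint_iff]) (IsSelfAdjoint.add_star_self a)
    · rw [map_smul, map_add, map_star, hsa.star_eq, ← two_smul ℂ, smul_smul]
      norm_num

theorem centralMultiplicativeDomain_map_mem_center {h1 : φ 1 = 1} {a : A}
    (ha : a ∈ centralMultiplicativeDomain φ h1) :
    φ a ∈ vonNeumannCenter (generatedVonNeumann (Set.range φ)) := by
  refine ⟨subset_generatedVonNeumann _ ⟨a, rfl⟩, fun y hy => ?_⟩
  have hcomm : φ a ∈ StarSubalgebra.centralizer ℂ (Set.range φ) := by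
    rw [StarSubalgebra.mem_centralizer_iff]
    rintro _ ⟨x, rfl⟩
    -- The centralizer also tests against adjoints; `star (φ x) = φ (star x)` is again in the range.
    exact ⟨((ha x).2.2).symm, by rw [← map_star, (ha _).2.2]⟩
  exact ((StarSubalgebra.mem_centralizer_iff (R := ℂ)).mp hy _ hcomm).1.symm

end EntanglementBreaking

theorem mainTheorem7 {A : Type*} [CStarAlgebra A] [PartialOrder A] [StarOrderedRing A]
    {H : Type*} [NormedAddCommGroup H] [InnerProductSpace ℂ H] [CompleteSpace H]
    (φ : A →ₚ[ℂ] (H →L[ℂ] H)) (hφ_one : φ 1 = 1) (hφ : IsEntanglementBreaking φ) :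
    (∀ e ∈ definiteSet φ, IsStarProjection e →
      IsStarProjection (φ e) ∧ IsStarProjection (φ (1 - e)) ∧
      ∀ x : A, φ x = φ (e * x * e) + φ ((1 - e) * x * (1 - e)) ∧
        φ x = φ e * φ x * φ e + φ (1 - e) * φ x * φ (1 - e)) ∧
    (∃ C : StarSubalgebra ℂ (H →L[ℂ] H),
      IsSelfAdjointPartOfAbelian C (φ '' definiteSet φ) ∧
      (C : Set (H →L[ℂ] H)) ⊆ vonNeumannCenter (generatedVonNeumann (Set.range φ))) ∧
    (IsFaithfulMap φ → ∃ D : StarSubalgebra ℂ A, IsSelfAdjointPartOfAbelian D (definiteSet φ)) := by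
  refine ⟨fun e he hproj => ?_, ⟨(centralMultiplicativeDomainHom φ hφ_one).range,
      ⟨isClosed_range_centralMultiplicativeDomainHom hφ_one hφ, ?_,
        image_definiteSet hφ_one hφ⟩, ?_⟩,
    fun hf => ⟨centralMultiplicativeDomain φ hφ_one,
      isClosed_centralMultiplicativeDomain φ hφ_one,
      fun x hx y hy => centralMultiplicativeDomain_mul_comm hf hx hy,
      definiteSet_eq_selfAdjoint_centralMultiplicativeDomain hφ_one hφ⟩⟩
  · have hm := definiteSet_subset_centralMultiplicativeDomain hφ_one hφ he
    have hm' : 1 - e ∈ centralMultiplicativeDomain φ hφ_one := sub_mem (one_mem _) hm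
    have hproj' : IsStarProjection (1 - e) := hproj.one_sub
    have hp {p : A} (hp : p ∈ centralMultiplicativeDomain φ hφ_one) (h : IsStarProjection p) :
        IsStarProjection (φ p) :=
      ⟨by rw [IsIdempotentElem, ← (hp p).1, h.isIdempotentElem.eq], h.isSelfAdjoint.map φ⟩
    have hpx {p : A} (hp' : p ∈ centralMultiplicativeDomain φ hφ_one) (h : IsStarProjection p)
        (x : A) : φ (p * x * p) = φ p * φ x * φ p ∧ φ p * φ x * φ p = φ p * φ x := by
      refine ⟨by rw [(hp' _).2.1, (hp' _).1], ?_⟩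
      rw [mul_assoc, ← (hp' x).2.2, ← mul_assoc, (hp hp' h).isIdempotentElem.eq]
    -- Each compression collapses to `φ p * φ x`, because `φ p` is a projection commuting with `φ
    -- x`; then `φ e + φ (1 - e) = 1`.
    have key (x : A) : φ x = φ e * φ x * φ e + φ (1 - e) * φ x * φ (1 - e) := by
      rw [(hpx hm hproj x).2, (hpx hm' hproj' x).2, ← add_mul, ← map_add, add_sub_cancel, hφ_one,
        one_mul]
    refine ⟨hp hm hproj, hp hm' hproj', fun x => ⟨?_, key x⟩⟩
    rw [(hpx hm hproj x).1, (hpx hm' hproj' x).1]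
    exact key x
  · intro x hx y hy
    obtain ⟨a, ha, rfl⟩ := mem_range_centralMultiplicativeDomainHom.mp hx
    obtain ⟨b, -, rfl⟩ := mem_range_centralMultiplicativeDomainHom.mp hy
    exact (ha b).2.2
  · intro y hy
    obtain ⟨a, ha, rfl⟩ := mem_range_centralMultiplicativeDomainHom.mp hy
    exact centralMultiplicativeDomain_map_mem_center ha
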